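/- Let $d\ge 1$ and let $L_2(\mathbb R^d)$ be the Hilbert space of complex-valued square-integrable functions on $\mathbb R^d$. For $L\in\mathbb R^d\setminus\{0\}$ consider the operators in $L_2(\mathbb R^d)$ $$ \mathcal A_L f(x)=2\pi\langle L,x\rangle f(x),\qquad \mathcal B_L f(x)=\frac{\mathrm i}{2\pi}\frac{\partial f}{\partial L}(x),\qquad \frac{\partial f}{\partial L}=\sum_{j=1}^d L_j\frac{\partial f}{\partial x_j} $$ (weak derivatives), with domains $\mathcal D(\mathcal A_L)=\{f\in L_2(\mathbb R^d):\int_{\mathbb R^d}\|x\|^2|f(x)|^2\,\mathrm dx<\infty\}$ and $\mathcal D(\mathcal B_L)=H^1(\mathbb R^d)$, the space of all $f\in L_2(\mathbb R^d)$ whose first-order derivatives are in $L_2(\mathbb R^d)$. For an operator $\mathcal T$ in $L_2(\mathbb R^d)$ and a non-zero $f\in\mathcal D(\mathcal T)$ put $\Delta(\mathcal T,f)=\|\mathcal T f\|_2^2-|\langle \mathcal T f,f\rangle|^2/\|f\|_2^2$, and for a non-zero $f\in\mathcal D(\mathcal A_L)\cap\mathcal D(\mathcal B_L)$ put $$ \mathrm{UP}_L(f)=\frac{\Delta(\mathcal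 A_L,f)\,\Delta(\mathcal B_L,f)}{\|L\|^4\,\|f\|_2^4}. $$ Lemma 3.6. Let $L\in\mathbb R^d\setminus\{0\}$ and let $f\in\mathcal D(\mathcal A_L)\cap\mathcal D(\mathcal B_L)$ be non-zero and odd in each coordinate separately, that is, for every $k=1,\dots,d$, $$ f(x_1,\dots,x_k,\dots,x_d)=-f(x_1,\dots,-x_k,\dots,x_d)\qquad\text{for almost every } x\in\mathbb R^d. $$ Then $$ \mathrm{UP}_L(f)\ge\frac94 . $$ -/

import Mathlib

open MeasureTheory
open scoped SchwartzMap LineDeriv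

noncomputable section

namespace DirectionalUncertainty

/-- The Euclidean space `ℝ^d`. -/
abbrev Space (d : ℕ) : Type := EuclideanSpace ℝ (Fin d)

/-- The Hilbert space `L_2(ℝ^d)` of (classes of) complex-valued square-integrable functions. -/
abbrev L2 (d : ℕ) : Type := Lp ℂ 2 (volume : Measure (Space d))

/-! ### The operator of multiplication by `2π⟨L, x⟩` -/

theorem memLp_norm_smul_iff {d : ℕ} (f : L2 d) :
    Integrable (fun x : Space d => ‖x‖ ^ 2 * ‖f x‖ ^ 2) ↔
      MemLp (fun x : Space d => ‖x‖ • f x) 2 := by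
  have hm : AEStronglyMeasurable (fun x : Space d => ‖x‖ • f x) volume :=
    continuous_norm.aestronglyMeasurable.smul (Lp.aestronglyMeasurable f)
  rw [memLp_two_iff_integrable_sq_norm hm]
  refine iff_of_eq (congrArg (fun F : Space d → ℝ => Integrable F volume) ?_)
  funext x
  simp [mul_pow]

/-- The space `{f ∈ L_2(ℝ^d) : ∫ ‖x‖² |f(x)|² dx < ∞}`. -/
def positionDomain (d : ℕ) : Submodule ℂ (L2 d) where
  carrier := {f | Integrable (fun x : Space d => ‖x‖ ^ 2 * ‖f x‖ ^ 2)}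
  zero_mem' := by
    rw [Set.mem_ofPred_eq, memLp_norm_smul_iff]
    refine MemLp.ae_eq ?_ (MemLp.zero' (ε := ℂ) (p := 2) (μ := (volume : Measure (Space d))))
    filter_upwards [Lp.coeFn_zero ℂ 2 (volume : Measure (Space d))] with x hx
    rw [hx, Pi.zero_apply, smul_zero]
  add_mem' := by
    intro f g hf hg
    have hf' := (memLp_norm_smul_iff f).1 hf
    have hg' := (memLp_norm_smul_iff g).1 hg
    rw [Set.mem_ofPred_eq, memLp_norm_smul_iff]
    refine MemLp.ae_eq ?_ (hf'.add hg')
    filter_upwards [Lp.coeFn_add f g] with x hx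
    rw [hx, Pi.add_apply, Pi.add_apply, smul_add]
  smul_mem' := by
    intro c f hf
    have hf' := (memLp_norm_smul_iff f).1 hf
    rw [Set.mem_ofPred_eq, memLp_norm_smul_iff]
    refine MemLp.ae_eq ?_ (hf'.const_smul c)
    filter_upwards [Lp.coeFn_smul c f] with x hx
    simp [hx, mul_left_comm]

theorem memLp_position {d : ℕ} (L : Space d) {f : L2 d} (hf : f ∈ positionDomain d) :
    MemLp (fun x : Space d => ((2 * Real.pi * inner ℝ L x : ℝ) : ℂ) * f x) 2 := by
  have h : Integrable (fun x : Space d => ‖x‖ ^ 2 * ‖f x‖ ^ 2) := hf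
  refine MemLp.of_le_mul (c := 2 * Real.pi * ‖L‖) ((memLp_norm_smul_iff f).1 h) ?_ ?_
  · refine AEStronglyMeasurable.mul ?_ (Lp.aestronglyMeasurable f)
    exact Continuous.aestronglyMeasurable (by fun_prop)
  · refine Filter.Eventually.of_forall fun x => ?_
    have h1 : |inner ℝ L x| ≤ ‖L‖ * ‖x‖ := abs_real_inner_le_norm L x
    have h2 : (0 : ℝ) ≤ 2 * Real.pi := by positivity
    rw [norm_mul, norm_smul, Complex.norm_real, Real.norm_eq_abs, abs_mul, abs_of_nonneg h2,
      norm_norm]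
    calc 2 * Real.pi * |inner ℝ L x| * ‖f x‖
        ≤ 2 * Real.pi * (‖L‖ * ‖x‖) * ‖f x‖ := by gcongr
      _ = 2 * Real.pi * ‖L‖ * (‖x‖ * ‖f x‖) := by ring

/-- The operator `A_L f(x) = 2π ⟨L, x⟩ f(x)` in `L_2(ℝ^d)`, with domain
`{f ∈ L_2(ℝ^d) : ∫ ‖x‖² |f(x)|² dx < ∞}`. -/
def opA {d : ℕ} (L : Space d) : L2 d →ₗ.[ℂ] L2 d where
  domain := positionDomain d
  toFun :=
    { toFun := fun f => (memLp_position L f.2).toLp _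
      map_add' := by
        intro f g
        refine Lp.ext ?_
        filter_upwards [(memLp_position L (f + g).2).coeFn_toLp,
          (memLp_position L f.2).coeFn_toLp, (memLp_position L g.2).coeFn_toLp,
          Lp.coeFn_add ((memLp_position L f.2).toLp _) ((memLp_position L g.2).toLp _),
          Lp.coeFn_add (f : L2 d) (g : L2 d)] with x h1 h2 h3 h4 h5
        rw [h1, h4, Pi.add_apply, h2, h3, Submodule.coe_add, h5, Pi.add_apply, mul_add]
      map_smul' := by
        intro c f
        refine Lp.ext ?_
        filter_upwards [(memLp_position L (c • f).2).coeFn_toLp,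
          (memLp_position L f.2).coeFn_toLp,
          Lp.coeFn_smul c ((memLp_position L f.2).toLp _),
          Lp.coeFn_smul c (f : L2 d)] with x h1 h2 h3 h4
        rw [h1, RingHom.id_apply, h3, Pi.smul_apply, h2, Submodule.coe_smul, h4, Pi.smul_apply,
          smul_eq_mul, smul_eq_mul, mul_left_comm] }

/-! ### The operator `(i / 2π) ∂/∂L` -/

/-- `g ∈ L_2(ℝ^d)` is the weak partial derivative `∂f/∂x_j` of `f ∈ L_2(ℝ^d)`, i.e.
`∫ φ g = - ∫ (∂φ/∂x_j) f` for all Schwartz functions `φ`. -/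
def IsWeakPartial {d : ℕ} (j : Fin d) (f g : L2 d) : Prop :=
  ∂_{(EuclideanSpace.single j (1 : ℝ) : Space d)} (Lp.toTemperedDistribution f) =
    Lp.toTemperedDistribution g

theorem isWeakPartial_iff {d : ℕ} (j : Fin d) (f g : L2 d) :
    IsWeakPartial j f g ↔ ∀ φ : 𝓢(Space d, ℂ),
      ∫ x, φ x * g x = - ∫ x, (∂_{(EuclideanSpace.single j (1 : ℝ) : Space d)} φ) x * f x := by
  unfold IsWeakPartial
  constructor
  · intro h φ
    have h1 := DFunLike.congr_fun h φ
    simpa [integral_neg] using h1.symm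
  · intro h
    ext φ
    simpa [integral_neg] using (h φ).symm

theorem IsWeakPartial.unique {d : ℕ} {j : Fin d} {f g h : L2 d}
    (hg : IsWeakPartial j f g) (hh : IsWeakPartial j f h) : g = h := by
  have hk := Lp.ker_toTemperedDistributionCLM_eq_bot (F := ℂ)
    (μ := (volume : Measure (Space d))) (p := 2)
  exact LinearMap.ker_eq_bot.1 hk (hg.symm.trans hh)

theorem IsWeakPartial.add {d : ℕ} {j : Fin d} {f g f' g' : L2 d}
    (h : IsWeakPartial j f f') (h' : IsWeakPartial j g g') :
    IsWeakPartial j (f + g) (f' + g') := by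
  unfold IsWeakPartial at *
  simp only [← Lp.toTemperedDistributionCLM_apply] at *
  rw [map_add, map_add, LineDeriv.lineDerivOp_add, h, h']

theorem IsWeakPartial.smul {d : ℕ} {j : Fin d} {f f' : L2 d} (c : ℂ)
    (h : IsWeakPartial j f f') : IsWeakPartial j (c • f) (c • f') := by
  unfold IsWeakPartial at *
  simp only [← Lp.toTemperedDistributionCLM_apply] at *
  rw [map_smul, map_smul, LineDeriv.lineDerivOp_smul, h]

/-- The Sobolev space `H^1(ℝ^d)`: functions in `L_2(ℝ^d)` all of whose weak derivatives of the
first order are in `L_2(ℝ^d)`. -/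
def sobolevH1 (d : ℕ) : Submodule ℂ (L2 d) where
  carrier := {f | ∀ j : Fin d, ∃ g : L2 d, IsWeakPartial j f g}
  zero_mem' := fun j => ⟨0, by
    rw [isWeakPartial_iff]
    intro φ
    have h0 := Lp.coeFn_zero ℂ 2 (volume : Measure (Space d))
    rw [integral_eq_zero_of_ae, integral_eq_zero_of_ae, neg_zero]
    · filter_upwards [h0] with x hx
      rw [hx, Pi.zero_apply, mul_zero]
    · filter_upwards [h0] with x hx
      rw [hx, Pi.zero_apply, mul_zero]⟩
  add_mem' := fun {f g} hf hg j => by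
    obtain ⟨f', hf'⟩ := hf j
    obtain ⟨g', hg'⟩ := hg j
    exact ⟨f' + g', hf'.add hg'⟩
  smul_mem' := fun c f hf j => by
    obtain ⟨f', hf'⟩ := hf j
    exact ⟨c • f', hf'.smul c⟩

/-- The weak partial derivative `∂/∂x_j : H^1(ℝ^d) → L_2(ℝ^d)`. -/
def weakPartial {d : ℕ} (j : Fin d) : sobolevH1 d →ₗ[ℂ] L2 d where
  toFun f := (f.2 j).choose
  map_add' f g :=
    ((f + g).2 j).choose_spec.unique ((f.2 j).choose_spec.add (g.2 j).choose_spec)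
  map_smul' c f := ((c • f).2 j).choose_spec.unique ((f.2 j).choose_spec.smul c)

theorem weakPartial_spec {d : ℕ} (j : Fin d) (f : sobolevH1 d) :
    IsWeakPartial j (f : L2 d) (weakPartial j f) :=
  (f.2 j).choose_spec

/-- The operator `B_L f = (i / 2π) ∂f/∂L` in `L_2(ℝ^d)`, where `∂f/∂L = ∑ j, L_j ∂f/∂x_j`, with
domain `H^1(ℝ^d)`. -/
def opB {d : ℕ} (L : Space d) : L2 d →ₗ.[ℂ] L2 d where
  domain := sobolevH1 d
  toFun := (Complex.I / (2 * Real.pi)) • ∑ j : Fin d, (L j : ℂ) • weakPartial j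

/-! ### Variances and the directional uncertainty product -/

/-- The variance `Δ(T, f) = ‖T f‖² - |⟨T f, f⟩|² / ‖f‖²` of `f ∈ D(T)`, `f ≠ 0`, with respect to
an operator `T` in a Hilbert space. -/
def variance {H : Type*} [NormedAddCommGroup H] [InnerProductSpace ℂ H]
    (T : H →ₗ.[ℂ] H) (f : T.domain) : ℝ :=
  ‖T f‖ ^ 2 - ‖inner ℂ (T f) (f : H)‖ ^ 2 / ‖(f : H)‖ ^ 2

/-- The directional uncertainty product
`UP_L(f) = Δ(A_L, f) Δ(B_L, f) / (‖L‖⁴ ‖f‖⁴)` of a non-zero `f ∈ D(A_L) ∩ D(B_L)`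
along `L ∈ ℝ^d`, `L ≠ 0`. -/
def UP {d : ℕ} (L : Space d) (f : ↥((opA L).domain ⊓ (opB L).domain)) : ℝ :=
  variance (opA L) ⟨f, f.2.1⟩ * variance (opB L) ⟨f, f.2.2⟩ /
    (‖L‖ ^ 4 * ‖(f : L2 d)‖ ^ 4)

/-- The reflection `(x_1, …, x_k, …, x_d) ↦ (x_1, …, -x_k, …, x_d)`. -/
def reflectCoord {d : ℕ} (k : Fin d) (x : Space d) : Space d :=
  WithLp.toLp 2 (Function.update x.ofLp k (-x k))

end DirectionalUncertainty

end

open Filter Topology FourierTransform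

noncomputable section

namespace DirectionalUncertainty

/-! ### Reflections -/

/-! Write `A_L f` as the sum of `L_k · 2π x_k f`, and `B_L f` as a constant times the sum of `L_k
∂_k f`. If `f` is odd in every coordinate, then `x_k f` and `∂_k f` are even in `x_k` and odd in the
other coordinates. Reflections are isometries, so the summands are pairwise orthogonal and
orthogonal to `f`: both means vanish, and the variances are sums of `L_k² ‖2π x_k f‖²` and of `L_k²
‖∂_k f‖² / (2π)²`.

What remains is `3l ‖f‖² ≤ ‖∂_k f‖² + l² ‖x_k f‖²` for `l ≥ 0`
(`IsWeakPartial.three_mul_norm_sq_le`); 3 is the lowest odd eigenvalue of the oscillator `-d²/dt² +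
t²`. Summing with weights `L_k²` and the same `l` for all `k` gives a quadratic polynomial in `l`
that is nonnegative, and its discriminant yields 9/4 (`nine_mul_sq_le_of_odd`).

The coordinate inequality comes from `∫ ‖∂φ + pφ‖² ≥ 0` with `p(t) = lt - 1/t`, which annihilates
the odd ground state `t exp(-lt²/2)`: integration by parts leaves the weight `p² - p' = l²t² - 3l`.
Since `p` is unbounded at zero and at infinity, it is replaced by `lt/(1+δt²) - t/(t²+ε)`. The limit
`ε → 0` is taken for odd Schwartz functions, which vanish on `x_k = 0`; the result extends to `f` by
density in the graph norm, the weight being bounded for fixed `δ`; finally `δ → 0`, using `x_k f ∈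
L_2`. -/

@[simp]
theorem reflectCoord_apply_same {d : ℕ} (k : Fin d) (x : Space d) :
    reflectCoord k x k = -x k := by
  simp [reflectCoord]

theorem reflectCoord_apply_of_ne {d : ℕ} {j k : Fin d} (h : j ≠ k) (x : Space d) :
    reflectCoord k x j = x j := by
  simp [reflectCoord, Function.update_of_ne h]

@[simp]
theorem reflectCoord_reflectCoord {d : ℕ} (k : Fin d) (x : Space d) :
    reflectCoord k (reflectCoord k x) = x := by
  ext j
  by_cases h : j = k
  · subst h; simp
  · rw [reflectCoord_apply_of_ne h, reflectCoord_apply_of_ne h]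

/-- The coordinate reflection as a linear isometry of `ℝ^d`. -/
def reflectIsometry {d : ℕ} (k : Fin d) : Space d ≃ₗᵢ[ℝ] Space d :=
  LinearIsometryEquiv.piLpCongrRight 2
    fun i => if i = k then LinearIsometryEquiv.neg ℝ else LinearIsometryEquiv.refl ℝ ℝ

theorem coe_reflectIsometry {d : ℕ} (k : Fin d) :
    ⇑(reflectIsometry k) = reflectCoord k := by
  funext x
  ext j
  by_cases h : j = k
  · subst h; simp [reflectIsometry]
  · rw [reflectCoord_apply_of_ne h]; simp [reflectIsometry, h]

theorem measurePreserving_reflectCoord {d : ℕ} (k : Fin d) :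
    MeasurePreserving (reflectCoord k) (volume : Measure (Space d)) volume :=
  coe_reflectIsometry k ▸ (reflectIsometry k).measurePreserving

theorem integral_comp_reflectCoord {d : ℕ} {F : Type*} [NormedAddCommGroup F] [NormedSpace ℝ F]
    (k : Fin d) (u : Space d → F) : ∫ x, u (reflectCoord k x) = ∫ x, u x := by
  have h := (measurePreserving_reflectCoord k).integral_comp
    (by rw [← coe_reflectIsometry]; exact (reflectIsometry k).toHomeomorph.measurableEmbedding) u
  exact h

/-- Composition with a coordinate reflection as an isometry of `L_2(ℝ^d)`. -/
def reflectOp {d : ℕ} (k : Fin d) : L2 d →ₗᵢ[ℂ] L2 d :=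
  Lp.compMeasurePreservingₗᵢ ℂ (reflectCoord k) (measurePreserving_reflectCoord k)

theorem coeFn_reflectOp {d : ℕ} (k : Fin d) (f : L2 d) :
    reflectOp k f =ᵐ[volume] fun x => f (reflectCoord k x) :=
  Lp.coeFn_compMeasurePreserving f (measurePreserving_reflectCoord k)

/-- Composition of a Schwartz function with a coordinate reflection. -/
def reflectSchwartz {d : ℕ} (k : Fin d) (φ : 𝓢(Space d, ℂ)) : 𝓢(Space d, ℂ) :=
  SchwartzMap.compCLMOfContinuousLinearEquiv ℂ
    (reflectIsometry k).toContinuousLinearEquiv φ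

@[simp]
theorem reflectSchwartz_apply {d : ℕ} (k : Fin d) (φ : 𝓢(Space d, ℂ)) (x : Space d) :
    reflectSchwartz k φ x = φ (reflectCoord k x) := by
  simp [reflectSchwartz, coe_reflectIsometry]

theorem reflectOp_toLp {d : ℕ} (k : Fin d) (φ : 𝓢(Space d, ℂ)) :
    reflectOp k (φ.toLp 2) = (reflectSchwartz k φ).toLp 2 := by
  refine Lp.ext ?_
  filter_upwards [coeFn_reflectOp k (φ.toLp 2), (reflectSchwartz k φ).coeFn_toLp 2,
    (measurePreserving_reflectCoord k).quasiMeasurePreserving.ae_eq_comp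
      (φ.coeFn_toLp 2 volume)] with x h1 h2 h3
  rw [h1, h2, reflectSchwartz_apply]
  exact h3

theorem reflectIsometry_single_same {d : ℕ} (k : Fin d) :
    reflectIsometry k (EuclideanSpace.single k (1 : ℝ)) = -EuclideanSpace.single k (1 : ℝ) := by
  rw [coe_reflectIsometry]
  ext j
  by_cases h : j = k
  · subst h; simp
  · rw [reflectCoord_apply_of_ne h]; simp [h]

theorem reflectIsometry_single_of_ne {d : ℕ} {j k : Fin d} (h : j ≠ k) :
    reflectIsometry k (EuclideanSpace.single j (1 : ℝ)) = EuclideanSpace.single j (1 : ℝ) := by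
  rw [coe_reflectIsometry]
  ext i
  by_cases hi : i = k
  · subst hi; simp [h.symm]
  · rw [reflectCoord_apply_of_ne hi]

theorem lineDeriv_reflectSchwartz_same {d : ℕ} (k : Fin d) (φ : 𝓢(Space d, ℂ)) :
    ∂_{(EuclideanSpace.single k (1 : ℝ) : Space d)} (reflectSchwartz k φ) =
      -reflectSchwartz k (∂_{(EuclideanSpace.single k (1 : ℝ) : Space d)} φ) := by
  have h : (reflectIsometry k).toContinuousLinearEquiv (EuclideanSpace.single k (1 : ℝ)) =
      -EuclideanSpace.single k (1 : ℝ) := reflectIsometry_single_same k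
  rw [reflectSchwartz, SchwartzMap.lineDerivOp_compCLMOfContinuousLinearEquiv, h,
    LineDeriv.lineDerivOp_left_neg, map_neg, reflectSchwartz]

theorem lineDeriv_reflectSchwartz_of_ne {d : ℕ} {j k : Fin d} (hjk : j ≠ k)
    (φ : 𝓢(Space d, ℂ)) :
    ∂_{(EuclideanSpace.single j (1 : ℝ) : Space d)} (reflectSchwartz k φ) =
      reflectSchwartz k (∂_{(EuclideanSpace.single j (1 : ℝ) : Space d)} φ) := by
  have h : (reflectIsometry k).toContinuousLinearEquiv (EuclideanSpace.single j (1 : ℝ)) =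
      EuclideanSpace.single j (1 : ℝ) := reflectIsometry_single_of_ne hjk
  rw [reflectSchwartz, SchwartzMap.lineDerivOp_compCLMOfContinuousLinearEquiv, h, reflectSchwartz]

/-! ### Parity of weak derivatives -/

theorem integral_mul_reflectOp {d : ℕ} (k : Fin d) (φ : 𝓢(Space d, ℂ)) (g : L2 d) :
    ∫ x, φ x * reflectOp k g x = ∫ x, reflectSchwartz k φ x * g x := by
  rw [← integral_comp_reflectCoord k fun x => reflectSchwartz k φ x * g x]
  refine integral_congr_ae ?_
  filter_upwards [coeFn_reflectOp k g] with x hx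
  rw [hx, reflectSchwartz_apply, reflectCoord_reflectCoord]

theorem integral_mul_neg {d : ℕ} (φ : 𝓢(Space d, ℂ)) (g : L2 d) :
    ∫ x, φ x * (-g : L2 d) x = -∫ x, φ x * g x := by
  rw [← integral_neg]
  refine integral_congr_ae ?_
  filter_upwards [Lp.coeFn_neg g] with x hx
  rw [hx, Pi.neg_apply, mul_neg]

theorem IsWeakPartial.reflectOp_same {d : ℕ} {k : Fin d} {f g : L2 d}
    (h : IsWeakPartial k f g) : IsWeakPartial k (reflectOp k f) (-reflectOp k g) := by
  rw [isWeakPartial_iff] at h ⊢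
  intro φ
  rw [integral_mul_neg, integral_mul_reflectOp, integral_mul_reflectOp, h,
    lineDeriv_reflectSchwartz_same]
  simp [integral_neg]

theorem IsWeakPartial.reflectOp_of_ne {d : ℕ} {j k : Fin d} (hjk : j ≠ k) {f g : L2 d}
    (h : IsWeakPartial j f g) : IsWeakPartial j (reflectOp k f) (reflectOp k g) := by
  rw [isWeakPartial_iff] at h ⊢
  intro φ
  rw [integral_mul_reflectOp, integral_mul_reflectOp, h, lineDeriv_reflectSchwartz_of_ne hjk]

/-- Both `-reflectOp k g` and `-g` are weak derivatives of `reflectOp k f = -f`, and weak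
derivatives are unique. -/
theorem IsWeakPartial.reflectOp_eq_of_odd {d : ℕ} {k : Fin d} {f g : L2 d}
    (h : IsWeakPartial k f g) (hf : reflectOp k f = -f) : reflectOp k g = g := by
  have h1 := h.reflectOp_same
  rw [hf, ← neg_one_smul ℂ f] at h1
  have h2 := h1.unique (h.smul (-1))
  rwa [neg_one_smul, neg_inj] at h2

theorem IsWeakPartial.reflectOp_eq_neg_of_odd {d : ℕ} {j k : Fin d} (hjk : j ≠ k) {f g : L2 d}
    (h : IsWeakPartial j f g) (hf : reflectOp k f = -f) : reflectOp k g = -g := by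
  have h1 := h.reflectOp_of_ne hjk
  rw [hf, ← neg_one_smul ℂ f] at h1
  have h2 := h1.unique (h.smul (-1))
  rwa [neg_one_smul] at h2

theorem reflectOp_eq_neg {d : ℕ} {k : Fin d} {f : L2 d}
    (h : ∀ᵐ x : Space d, f x = -f (reflectCoord k x)) : reflectOp k f = -f := by
  refine Lp.ext ?_
  filter_upwards [coeFn_reflectOp k f, h, Lp.coeFn_neg f] with x h1 h2 h3
  rw [h1, h3, Pi.neg_apply, h2, neg_neg]

/-! ### Approximation of weak derivatives by Schwartz functions -/

theorem exists_schwartzMap_eq_ofReal {d : ℕ} {u : Space d → ℝ} (hu : ContDiff ℝ (⊤ : ℕ∞) u)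
    (hc : HasCompactSupport u) : ∃ ψ : 𝓢(Space d, ℂ), ∀ x, ψ x = (u x : ℂ) := by
  have h1 : HasCompactSupport (Complex.ofRealCLM ∘ u) := hc.comp_left rfl
  have h2 : ContDiff ℝ (⊤ : ℕ∞) (Complex.ofRealCLM ∘ u) := by fun_prop
  exact ⟨h1.toSchwartzMap h2, fun x => rfl⟩

theorem IsWeakPartial.fourier_eq {d : ℕ} {j : Fin d} {f g : L2 d} (h : IsWeakPartial j f g) :
    (𝓕 g : L2 d) =ᵐ[volume] fun x => 2 * Real.pi * Complex.I * x j * (𝓕 f : L2 d) x := by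
  have h1 : 𝓕 (Lp.toTemperedDistribution g) =
      𝓕 (∂_{(EuclideanSpace.single j (1 : ℝ) : Space d)} (Lp.toTemperedDistribution f)) := by
    rw [h]
  rw [TemperedDistribution.fourier_lineDerivOp_eq, Lp.fourier_toTemperedDistribution_eq,
    Lp.fourier_toTemperedDistribution_eq] at h1
  have hG := (Lp.memLp (𝓕 g : L2 d)).locallyIntegrable one_le_two
  have hF := (Lp.memLp (𝓕 f : L2 d)).locallyIntegrable one_le_two
  -- Local integrability of both sides suffices: smooth compactly supported test functions then
  -- determine them almost everywhere.
  have hF' : LocallyIntegrable fun x => 2 * Real.pi * Complex.I * x j * (𝓕 f : L2 d) x := by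
    rw [← locallyIntegrableOn_univ] at hF ⊢
    exact hF.continuousOn_mul (by fun_prop) isOpen_univ.isLocallyClosed
  refine ae_eq_of_integral_contDiff_smul_eq hG hF' fun u hu hc => ?_
  obtain ⟨ψ, hψ⟩ := exists_schwartzMap_eq_ofReal hu hc
  have h2 := DFunLike.congr_fun h1 ψ
  have h3 : (fun x : Space d =>
      ((inner ℝ x (EuclideanSpace.single j (1 : ℝ)) : ℝ) : ℂ)).HasTemperateGrowth := by
    fun_prop
  rw [smul_apply, Lp.toTemperedDistribution_apply,
    TemperedDistribution.smulLeftCLM_apply_apply, Lp.toTemperedDistribution_apply, ← integral_smul] at h2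
  refine Eq.trans (integral_congr_ae (.of_forall fun x => ?_))
    (h2.trans (integral_congr_ae (.of_forall fun x => ?_)))
  · simp [hψ]
  · beta_reduce
    rw [SchwartzMap.smulLeftCLM_apply_apply h3]
    simp [hψ, EuclideanSpace.inner_single_right]
    ring

/-- The graph of the derivative on Schwartz functions, in the Hilbert space `L_2 × L_2`. -/
def schwartzGraph {d : ℕ} (j : Fin d) : 𝓢(Space d, ℂ) →ₗ[ℂ] WithLp 2 (L2 d × L2 d) :=
  (WithLp.linearEquiv 2 ℂ (L2 d × L2 d)).symm.toLinearMap ∘ₗ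
    ((SchwartzMap.toLpCLM ℂ ℂ 2 volume).toLinearMap.prod
      ((SchwartzMap.toLpCLM ℂ ℂ 2 volume).toLinearMap ∘ₗ
        (LineDeriv.lineDerivOpCLM ℂ 𝓢(Space d, ℂ)
          (EuclideanSpace.single j (1 : ℝ) : Space d)).toLinearMap))

theorem schwartzGraph_apply {d : ℕ} (j : Fin d) (φ : 𝓢(Space d, ℂ)) :
    schwartzGraph j φ = WithLp.toLp 2 (φ.toLp 2,
      (∂_{(EuclideanSpace.single j (1 : ℝ) : Space d)} φ).toLp 2) :=
  rfl

theorem isWeakPartial_toLp {d : ℕ} (j : Fin d) (φ : 𝓢(Space d, ℂ)) :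
    IsWeakPartial j (φ.toLp 2)
      ((∂_{(EuclideanSpace.single j (1 : ℝ) : Space d)} φ).toLp 2) := by
  rw [IsWeakPartial, Lp.toTemperedDistribution_toLp_eq, Lp.toTemperedDistribution_toLp_eq]
  exact TemperedDistribution.lineDerivOp_toTemperedDistributionCLM_eq _ _

/-- If `(u, v)` is orthogonal to the graph of the derivative, then `𝓕 u = 2πi x_j 𝓕 v`. -/
theorem fourier_eq_of_orthogonal {d : ℕ} {j : Fin d} {u v : L2 d}
    (h : ∀ φ : 𝓢(Space d, ℂ), inner ℂ (φ.toLp 2) u +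
      inner ℂ ((∂_{(EuclideanSpace.single j (1 : ℝ) : Space d)} φ).toLp 2) v = 0) :
    (𝓕 u : L2 d) =ᵐ[volume] fun x => 2 * Real.pi * Complex.I * x j * (𝓕 v : L2 d) x := by
  have hG := (Lp.memLp (𝓕 u : L2 d)).locallyIntegrable one_le_two
  have hF := (Lp.memLp (𝓕 v : L2 d)).locallyIntegrable one_le_two
  have hF' : LocallyIntegrable fun x => 2 * Real.pi * Complex.I * x j * (𝓕 v : L2 d) x := by
    rw [← locallyIntegrableOn_univ] at hF ⊢
    exact hF.continuousOn_mul (by fun_prop) isOpen_univ.isLocallyClosed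
  refine ae_eq_of_integral_contDiff_smul_eq hG hF' fun w hw hc => ?_
  obtain ⟨ψ, hψ⟩ := exists_schwartzMap_eq_ofReal hw hc
  -- Testing with the inverse transform of `ψ` puts the arbitrary bump `w` itself on the Fourier
  -- side after Plancherel.
  have h1 := h (𝓕⁻ ψ)
  have h2 := (isWeakPartial_toLp j (𝓕⁻ ψ)).fourier_eq
  rw [← Lp.inner_fourier_eq, ← Lp.inner_fourier_eq (SchwartzMap.toLp _ _ _) v, L2.inner_def,
    L2.inner_def, SchwartzMap.toLp_fourier_eq, fourier_fourierInv_eq,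
    add_eq_zero_iff_eq_neg, ← integral_neg] at h1
  rw [SchwartzMap.toLp_fourier_eq (𝓕⁻ ψ), fourier_fourierInv_eq] at h2
  refine Eq.trans (integral_congr_ae ?_) (h1.trans (integral_congr_ae ?_))
  · filter_upwards [ψ.coeFn_toLp 2 volume] with x hx
    rw [hx, hψ]
    simp [mul_comm]
  · filter_upwards [ψ.coeFn_toLp 2 volume, h2] with x hx hx2
    rw [hx2, hx, hψ]
    simp [map_ofNat]
    ring

/-- The closure is the double orthogonal complement. For a pair orthogonal to the graph, Plancherel
turns the two inner products into integrals whose integrands cancel pointwise, because the conjugate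
of `2πi x_j` is its negative. -/
theorem IsWeakPartial.mem_closure {d : ℕ} {j : Fin d} {f g : L2 d} (h : IsWeakPartial j f g) :
    (WithLp.toLp 2 (f, g) : WithLp 2 (L2 d × L2 d)) ∈
      (LinearMap.range (schwartzGraph j)).topologicalClosure := by
  rw [← Submodule.orthogonal_orthogonal_eq_closure, Submodule.mem_orthogonal']
  intro w hw
  have h1 : ∀ φ : 𝓢(Space d, ℂ), inner ℂ (φ.toLp 2) w.fst +
      inner ℂ ((∂_{(EuclideanSpace.single j (1 : ℝ) : Space d)} φ).toLp 2) w.snd = 0 := by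
    intro φ
    have := (Submodule.mem_orthogonal _ _).1 hw _ (LinearMap.mem_range_self _ φ)
    rwa [schwartzGraph_apply, WithLp.prod_inner_apply] at this
  have h2 := fourier_eq_of_orthogonal h1
  rw [WithLp.prod_inner_apply]
  change inner ℂ f w.fst + inner ℂ g w.snd = 0
  rw [← Lp.inner_fourier_eq, ← Lp.inner_fourier_eq g, L2.inner_def, L2.inner_def,
    add_eq_zero_iff_eq_neg, ← integral_neg]
  refine integral_congr_ae ?_
  filter_upwards [h2, h.fourier_eq] with x hx hx'
  rw [hx, hx']
  simp [map_ofNat]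
  ring

/-- Schwartz functions are dense in the domain of the weak derivative, for the graph norm. -/
theorem IsWeakPartial.exists_seq {d : ℕ} {j : Fin d} {f g : L2 d} (h : IsWeakPartial j f g) :
    ∃ φ : ℕ → 𝓢(Space d, ℂ), Tendsto (fun n => (φ n).toLp 2) atTop (𝓝 f) ∧
      Tendsto (fun n => (∂_{(EuclideanSpace.single j (1 : ℝ) : Space d)} (φ n)).toLp 2)
        atTop (𝓝 g) := by
  obtain ⟨w, hw, hlim⟩ := mem_closure_iff_seq_limit.1 h.mem_closure
  choose φ hφ using hw
  refine ⟨φ, ?_, ?_⟩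
  · have := ((WithLp.prod_continuous_ofLp 2 _ _).tendsto _).comp hlim
    refine (this.fst_nhds).congr fun n => ?_
    simp only [Function.comp_apply, ← hφ]
    rfl
  · have := ((WithLp.prod_continuous_ofLp 2 _ _).tendsto _).comp hlim
    refine (this.snd_nhds).congr fun n => ?_
    simp only [Function.comp_apply, ← hφ]
    rfl

/-- Functions odd in `x_j` are limits of such Schwartz functions. -/
theorem IsWeakPartial.exists_seq_odd {d : ℕ} {j : Fin d} {f g : L2 d} (h : IsWeakPartial j f g)
    (hf : reflectOp j f = -f) :
    ∃ φ : ℕ → 𝓢(Space d, ℂ), (∀ n x, φ n (reflectCoord j x) = -φ n x) ∧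
      Tendsto (fun n => (φ n).toLp 2) atTop (𝓝 f) ∧
      Tendsto (fun n => (∂_{(EuclideanSpace.single j (1 : ℝ) : Space d)} (φ n)).toLp 2)
        atTop (𝓝 g) := by
  obtain ⟨φ, h1, h2⟩ := h.exists_seq
  have hg := h.reflectOp_eq_of_odd hf
  have hadd (a b : 𝓢(Space d, ℂ)) : (a + b).toLp 2 volume = a.toLp 2 volume + b.toLp 2 volume :=
    map_add (SchwartzMap.toLpCLM ℂ ℂ 2 (volume : Measure (Space d))) a b
  have hsub (a b : 𝓢(Space d, ℂ)) : (a - b).toLp 2 volume = a.toLp 2 volume - b.toLp 2 volume :=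
    map_sub (SchwartzMap.toLpCLM ℂ ℂ 2 (volume : Measure (Space d))) a b
  have hsmul (c : ℂ) (a : 𝓢(Space d, ℂ)) : (c • a).toLp 2 volume = c • a.toLp 2 volume :=
    map_smul (SchwartzMap.toLpCLM ℂ ℂ 2 (volume : Measure (Space d))) c a
  -- Antisymmetrising is continuous in `L_2` and fixes `f`. It acts on the derivatives as
  -- symmetrising, which fixes `g`.
  refine ⟨fun n => (2⁻¹ : ℂ) • (φ n - reflectSchwartz j (φ n)), fun n x => ?_, ?_, ?_⟩
  · simp
    ring
  · have h3 := (h1.sub (((reflectOp j).continuous.tendsto _).comp h1)).const_smul (2⁻¹ : ℂ)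
    rw [hf, sub_neg_eq_add, ← two_smul ℂ f, smul_smul, inv_mul_cancel₀ two_ne_zero,
      one_smul] at h3
    refine h3.congr fun n => ?_
    rw [hsmul, hsub, ← reflectOp_toLp]
    rfl
  · have h3 := (h2.add (((reflectOp j).continuous.tendsto _).comp h2)).const_smul (2⁻¹ : ℂ)
    rw [hg, ← two_smul ℂ g, smul_smul, inv_mul_cancel₀ two_ne_zero, one_smul] at h3
    refine h3.congr fun n => ?_
    rw [LineDeriv.lineDerivOp_smul, sub_eq_add_neg, LineDeriv.lineDerivOp_add,
      LineDeriv.lineDerivOp_neg, lineDeriv_reflectSchwartz_same, neg_neg, hsmul, hadd, ← reflectOp_toLp]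
    rfl

/-! ### The uncertainty inequality for odd Schwartz functions -/

theorem hasLineDerivAt_schwartz {d : ℕ} (φ : 𝓢(Space d, ℂ)) (e x : Space d) :
    HasLineDerivAt ℝ φ (∂_{e} φ x) x e := by
  rw [SchwartzMap.lineDerivOp_apply_eq_fderiv]
  exact (φ.differentiableAt.hasFDerivAt).hasLineDerivAt e

theorem hasLineDerivAt_comp_coord {d : ℕ} {j : Fin d} {p : ℝ → ℝ} {p' : ℝ} {x : Space d}
    (hp : HasDerivAt p p' (x j)) :
    HasLineDerivAt ℝ (fun y : Space d => p (y j)) p' x (EuclideanSpace.single j 1) := by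
  have h1 : HasDerivAt (fun t : ℝ => x j + t) 1 0 := (hasDerivAt_id (0 : ℝ)).const_add (x j)
  have h2 : HasDerivAt p p' (x j + 0) := by simpa using hp
  have h3 := h2.comp (0 : ℝ) h1
  rw [mul_one] at h3
  refine h3.congr_of_eventuallyEq (.of_forall fun t => ?_)
  simp

theorem integrable_norm_sq_schwartz {d : ℕ} (φ : 𝓢(Space d, ℂ)) :
    Integrable fun x => ‖φ x‖ ^ 2 :=
  (memLp_two_iff_integrable_sq_norm φ.continuous.aestronglyMeasurable).1 (φ.memLp 2 volume)

theorem integrable_inner_schwartz {d : ℕ} (φ ψ : 𝓢(Space d, ℂ)) :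
    Integrable fun x => inner ℝ (φ x) (ψ x) := by
  refine ((integrable_norm_sq_schwartz φ).add (integrable_norm_sq_schwartz ψ)).mono'
    (φ.continuous.inner ψ.continuous).aestronglyMeasurable (.of_forall fun x => ?_)
  have h := norm_inner_le_norm (𝕜 := ℝ) (φ x) (ψ x)
  simp only [Pi.add_apply]
  nlinarith [sq_nonneg (‖φ x‖ - ‖ψ x‖), norm_nonneg (φ x), norm_nonneg (ψ x)]

theorem integrable_coord_mul {d : ℕ} {j : Fin d} {p : ℝ → ℝ} (hp : Continuous p) {K : ℝ}
    (hK : ∀ t, |p t| ≤ K) {u : Space d → ℝ} (hu : Integrable u) :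
    Integrable fun x => p (x j) * u x :=
  hu.bdd_mul (c := K) (Continuous.aestronglyMeasurable (by fun_prop)) (.of_forall fun x => hK _)

/-- Expanding `∫ ‖∂φ + p φ‖² ≥ 0` and integrating by parts. -/
theorem integral_norm_sq_lineDeriv_add_nonneg {d : ℕ} (j : Fin d) (φ : 𝓢(Space d, ℂ))
    {p p' : ℝ → ℝ} (hp : ∀ t, HasDerivAt p (p' t) t) (hp' : Continuous p') {K : ℝ}
    (hK : ∀ t, |p t| ≤ K) {K' : ℝ} (hK' : ∀ t, |p' t| ≤ K') :
    0 ≤ ∫ x, ‖∂_{(EuclideanSpace.single j (1 : ℝ) : Space d)} φ x‖ ^ 2 +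
      (p (x j) ^ 2 - p' (x j)) * ‖φ x‖ ^ 2 := by
  set ψ := ∂_{(EuclideanSpace.single j (1 : ℝ) : Space d)} φ with hψ
  have hpc : Continuous p := continuous_iff_continuousAt.2 fun t => (hp t).continuousAt
  have hK2 : ∀ t, |p t ^ 2| ≤ K ^ 2 := fun t => by
    rw [abs_pow]
    exact pow_le_pow_left₀ (abs_nonneg _) (hK t) 2
  have i1 := integrable_norm_sq_schwartz φ
  have i2 := integrable_norm_sq_schwartz ψ
  have i3 := (integrable_inner_schwartz φ ψ).const_mul 2
  have i4 := integrable_coord_mul (j := j) hpc hK i3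
  have i5 := integrable_coord_mul (j := j) hp' hK' i1
  have i6 : Integrable fun x : Space d => ‖ψ x‖ ^ 2 + p (x j) ^ 2 * ‖φ x‖ ^ 2 :=
    i2.add (integrable_coord_mul (p := fun t => p t ^ 2) (hpc.pow 2) hK2 i1)
  -- The derivative of `‖φ‖²` along `e_j` is `2⟨φ, ψ⟩` for the real inner product, so the cross term
  -- of the square integrates by parts.
  have ibp : ∫ x, p (x j) * (2 * inner ℝ (φ x) (ψ x)) = -∫ x, p' (x j) * ‖φ x‖ ^ 2 := by
    refine integral_bilinear_hasLineDerivAt_right_eq_neg_left_of_integrable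
      (B := ContinuousLinearMap.mul ℝ ℝ) (f := fun x : Space d => p (x j))
      (f' := fun x => p' (x j)) (v := EuclideanSpace.single j 1) i5 i4
      (integrable_coord_mul hpc hK i1) (fun x _ => hasLineDerivAt_comp_coord (hp _))
      fun x _ => ?_
    have h : HasDerivAt (fun t : ℝ => φ (x + t • EuclideanSpace.single j (1 : ℝ))) (ψ x) 0 :=
      hasLineDerivAt_schwartz φ (EuclideanSpace.single j 1) x
    simpa [HasLineDerivAt] using h.norm_sq
  calc 0 ≤ ∫ x, ‖ψ x + p (x j) • φ x‖ ^ 2 := integral_nonneg fun x => by positivity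
    _ = ∫ x, (‖ψ x‖ ^ 2 + p (x j) ^ 2 * ‖φ x‖ ^ 2) + p (x j) * (2 * inner ℝ (φ x) (ψ x)) := by
        refine integral_congr_ae (.of_forall fun x => ?_)
        simp only
        rw [norm_add_sq_real, norm_smul, real_inner_smul_right, mul_pow, Real.norm_eq_abs,
          sq_abs, real_inner_comm]
        ring
    _ = ∫ x, (‖ψ x‖ ^ 2 + p (x j) ^ 2 * ‖φ x‖ ^ 2) - p' (x j) * ‖φ x‖ ^ 2 := by
        rw [integral_add i6 i4, ibp, integral_sub i6 i5, sub_eq_add_neg]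
    _ = _ := integral_congr_ae (.of_forall fun x => by simp only; ring)

/-- The decay is stated at `x` while the derivative is taken at a nearby `y`, as the mean value
inequality on a ball around `x` requires. One factor `2 ^ N` comes from `1 + ‖x‖ ≤ 2 (1 + ‖y‖)`. -/
theorem exists_fderiv_decay {d : ℕ} (φ : 𝓢(Space d, ℂ)) (N : ℕ) :
    ∃ C, 0 ≤ C ∧ ∀ x y : Space d, ‖x - y‖ ≤ 1 → ‖fderiv ℝ φ y‖ ≤ C * ((1 + ‖x‖) ^ N)⁻¹ := by
  refine ⟨2 ^ N * (2 ^ N * ((Finset.Iic (N, 1)).sup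
    (schwartzSeminormFamily ℝ (Space d) ℂ)) φ), by positivity, fun x y hxy => ?_⟩
  have h1 := SchwartzMap.one_add_le_sup_seminorm_apply (𝕜 := ℝ) (m := (N, 1)) le_rfl le_rfl φ y
  rw [norm_iteratedFDeriv_one] at h1
  have h2 : (1 + ‖x‖) ^ N ≤ 2 ^ N * (1 + ‖y‖) ^ N := by
    rw [← mul_pow]
    refine pow_le_pow_left₀ (by positivity) ?_ N
    have := norm_le_norm_add_norm_sub' x y
    linarith [norm_nonneg y]
  rw [← div_eq_mul_inv, le_div_iff₀ (by positivity)]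
  calc ‖fderiv ℝ φ y‖ * (1 + ‖x‖) ^ N ≤ ‖fderiv ℝ φ y‖ * (2 ^ N * (1 + ‖y‖) ^ N) := by gcongr
    _ = 2 ^ N * ((1 + ‖y‖) ^ N * ‖fderiv ℝ φ y‖) := by ring
    _ ≤ _ := mul_le_mul_of_nonneg_left h1 (by positivity)

/-- A Schwartz function odd in `x_j` vanishes to first order on `x_j = 0`, uniformly. -/
theorem exists_integrable_bound_of_odd {d : ℕ} {j : Fin d} {φ : 𝓢(Space d, ℂ)}
    (hφ : ∀ x, φ (reflectCoord j x) = -φ x) :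
    ∃ Ψ : Space d → ℝ, Integrable Ψ ∧ (∀ x, 0 ≤ Ψ x) ∧ ∀ x, ‖φ x‖ ^ 2 ≤ x j ^ 2 * Ψ x := by
  -- The exponent `d + 1` exceeds the dimension, which makes the bound integrable.
  obtain ⟨C, hC0, hC⟩ := exists_fderiv_decay φ (d + 1)
  have hint : Integrable fun x : Space d => ((1 + ‖x‖) ^ (d + 1))⁻¹ := by
    have h := integrable_one_add_norm (E := Space d) (μ := volume) (r := (d + 1 : ℕ))
      (by simp)
    refine h.congr (.of_forall fun x => ?_)
    simp only
    rw [Real.rpow_neg (by positivity), Real.rpow_natCast]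
  refine ⟨fun x => ‖φ x‖ ^ 2 + C ^ 2 * ((1 + ‖x‖) ^ (d + 1))⁻¹,
    (integrable_norm_sq_schwartz φ).add (hint.const_mul _), fun x => by positivity, fun x => ?_⟩
  -- For `|x j| ≥ 1` the summand `‖φ x‖²` of the bound suffices. Otherwise `φ x` is compared with
  -- its value 0 at the projection `y` of `x` onto the hyperplane fixed by the reflection.
  rcases le_total 1 |x j| with h | h
  · have h1 : 1 ≤ x j ^ 2 := (one_le_sq_iff_one_le_abs _).2 h
    have h2 : 0 ≤ C ^ 2 * ((1 + ‖x‖) ^ (d + 1))⁻¹ := by positivity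
    nlinarith [sq_nonneg ‖φ x‖]
  · set y : Space d := x - EuclideanSpace.single j (x j) with hy
    have hxy : ‖x - y‖ = |x j| := by simp [hy]
    have hy0 : φ y = 0 := by
      have h1 : reflectCoord j y = y := by
        ext i
        by_cases hi : i = j
        · subst hi; simp [hy]
        · rw [reflectCoord_apply_of_ne hi]
      have h2 := hφ y
      rw [h1] at h2
      exact self_eq_neg.1 h2
    have h3 : ‖φ y - φ x‖ ≤ C * ((1 + ‖x‖) ^ (d + 1))⁻¹ * ‖y - x‖ := by
      refine (convex_closedBall x 1).norm_image_sub_le_of_norm_fderiv_le (𝕜 := ℝ)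
        (fun z _ => φ.differentiableAt) (fun z hz => hC x z ?_) (by simp) ?_
      · rw [norm_sub_rev, ← dist_eq_norm]; exact hz
      · rw [Metric.mem_closedBall, dist_eq_norm, norm_sub_rev, hxy]; exact h
    rw [hy0, zero_sub, norm_neg, norm_sub_rev, hxy] at h3
    have h4 : ((1 + ‖x‖) ^ (d + 1))⁻¹ ≤ 1 :=
      inv_le_one_of_one_le₀ (one_le_pow₀ (by linarith [norm_nonneg x]))
    have h5 : 0 ≤ ((1 + ‖x‖) ^ (d + 1))⁻¹ := by positivity
    calc ‖φ x‖ ^ 2 ≤ (C * ((1 + ‖x‖) ^ (d + 1))⁻¹ * |x j|) ^ 2 := by gcongr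
      _ = x j ^ 2 * (C ^ 2 * (((1 + ‖x‖) ^ (d + 1))⁻¹ * ((1 + ‖x‖) ^ (d + 1))⁻¹)) := by
          rw [mul_pow, sq_abs]; ring
      _ ≤ x j ^ 2 * (C ^ 2 * (1 * ((1 + ‖x‖) ^ (d + 1))⁻¹)) := by gcongr
      _ ≤ x j ^ 2 * (‖φ x‖ ^ 2 + C ^ 2 * ((1 + ‖x‖) ^ (d + 1))⁻¹) := by
          rw [one_mul]; gcongr; linarith [sq_nonneg ‖φ x‖]

/-- The weight obtained from the truncated multiplier `t / (1 + δ t²)`. -/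
def truncWeight (l δ t : ℝ) : ℝ :=
  l ^ 2 * (t / (1 + δ * t ^ 2)) ^ 2 - l * ((1 - δ * t ^ 2) / (1 + δ * t ^ 2) ^ 2) -
    2 * l / (1 + δ * t ^ 2)

/-! ### Estimates for the truncated weight and removal of the singularity -/

theorem abs_one_sub_div_le {s : ℝ} (hs : 0 ≤ s) : |(1 - s) / (1 + s) ^ 2| ≤ 1 := by
  rw [abs_div, abs_of_pos (by positivity : 0 < (1 + s) ^ 2), div_le_one (by positivity), abs_le]
  constructor <;> nlinarith

theorem sq_div_le {δ : ℝ} (hδ : 0 < δ) (t : ℝ) : (t / (1 + δ * t ^ 2)) ^ 2 ≤ δ⁻¹ := by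
  rw [div_pow, div_le_iff₀ (by positivity), inv_mul_eq_div, le_div_iff₀ hδ]
  nlinarith [mul_nonneg hδ.le (sq_nonneg t)]

/-- This form serves twice: with `sq_div_le` it bounds the weight for fixed `δ`, and with `(t / (1 +
δt²))² ≤ t²` it gives a majorant independent of `δ`. -/
theorem abs_truncWeight_le {l δ : ℝ} (hl : 0 ≤ l) (hδ : 0 < δ) (t : ℝ) :
    |truncWeight l δ t| ≤ l ^ 2 * (t / (1 + δ * t ^ 2)) ^ 2 + 3 * l := by
  have hs : 0 ≤ δ * t ^ 2 := by positivity
  have h1 := abs_le.1 (abs_one_sub_div_le hs)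
  have h2 : 0 ≤ l ^ 2 * (t / (1 + δ * t ^ 2)) ^ 2 := by positivity
  have h3 : 0 ≤ 2 * l / (1 + δ * t ^ 2) := by positivity
  have h4 : 2 * l / (1 + δ * t ^ 2) ≤ 2 * l := div_le_self (by positivity) (by linarith)
  rw [truncWeight, abs_le]
  constructor <;> nlinarith

theorem continuous_truncWeight {l δ : ℝ} (hδ : 0 < δ) : Continuous (truncWeight l δ) := by
  have h : ∀ t : ℝ, 1 + δ * t ^ 2 ≠ 0 := fun t => by positivity
  unfold truncWeight
  fun_prop (disch := first | exact h | exact fun _ => pow_ne_zero _ (h _))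

theorem hasDerivAt_div_one_add {δ : ℝ} (hδ : 0 < δ) (t : ℝ) :
    HasDerivAt (fun t : ℝ => t / (1 + δ * t ^ 2))
      ((1 - δ * t ^ 2) / (1 + δ * t ^ 2) ^ 2) t := by
  have h : 1 + δ * t ^ 2 ≠ 0 := by positivity
  have := (hasDerivAt_id t).div ((((hasDerivAt_id t).pow 2).const_mul δ).const_add 1) h
  refine this.congr_deriv ?_
  simp
  ring

theorem hasDerivAt_div_sq_add {ε : ℝ} (hε : 0 < ε) (t : ℝ) :
    HasDerivAt (fun t : ℝ => t / (t ^ 2 + ε)) ((ε - t ^ 2) / (t ^ 2 + ε) ^ 2) t := by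
  have h : t ^ 2 + ε ≠ 0 := by positivity
  have := (hasDerivAt_id t).div (((hasDerivAt_id t).pow 2).add_const ε) h
  refine this.congr_deriv ?_
  simp
  ring

/-- The multiplier is `lt/(1+δt²) - t/(t²+ε)`. The two terms with `ε` in the numerator are what `p²
- p'` leaves over when `1/t` is regularised; they vanish pointwise off `t = 0` as `ε → 0`. -/
theorem integral_truncWeight_add_regularised_nonneg {d : ℕ} (j : Fin d) (φ : 𝓢(Space d, ℂ))
    {l δ ε : ℝ} (hl : 0 ≤ l) (hδ : 0 < δ) (hε : 0 < ε) :
    0 ≤ ∫ x, ‖∂_{(EuclideanSpace.single j (1 : ℝ) : Space d)} φ x‖ ^ 2 +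
      (truncWeight l δ (x j) + ε / (x j ^ 2 + ε) ^ 2 +
        2 * l / (1 + δ * x j ^ 2) * (ε / (x j ^ 2 + ε))) * ‖φ x‖ ^ 2 := by
  have hd1 : ∀ t : ℝ, 1 + δ * t ^ 2 ≠ 0 := fun t => by positivity
  have hd2 : ∀ t : ℝ, t ^ 2 + ε ≠ 0 := fun t => by positivity
  have h := integral_norm_sq_lineDeriv_add_nonneg j φ
    (p := fun t => l * (t / (1 + δ * t ^ 2)) - t / (t ^ 2 + ε))
    (p' := fun t => l * ((1 - δ * t ^ 2) / (1 + δ * t ^ 2) ^ 2) - (ε - t ^ 2) / (t ^ 2 + ε) ^ 2)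
    (fun t => ((hasDerivAt_div_one_add hδ t).const_mul l).sub (hasDerivAt_div_sq_add hε t))
    (by fun_prop (disch := first | exact fun _ => pow_ne_zero _ (hd1 _) | exact fun _ => pow_ne_zero _ (hd2 _)))
    (K := l * (1 + δ⁻¹) + (1 + ε⁻¹)) (fun t => ?_) (K' := l * 1 + ε⁻¹) (fun t => ?_)
  · refine h.trans_eq (integral_congr_ae (.of_forall fun x => ?_))
    have h1 := hd1 (x j)
    have h2 := hd2 (x j)
    simp only [truncWeight]
    congr 2
    field_simp
    ring
  · have h1 := abs_le_of_sq_le_sq' (a := t / (1 + δ * t ^ 2)) (b := 1 + δ⁻¹)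
      (by nlinarith [sq_div_le hδ t, inv_pos.2 hδ]) (by positivity)
    have h2 : |t / (t ^ 2 + ε)| ≤ 1 + ε⁻¹ := by
      rw [abs_div, abs_of_pos (by positivity : 0 < t ^ 2 + ε), div_le_iff₀ (by positivity)]
      have h3 : (1 + ε⁻¹) * (t ^ 2 + ε) = t ^ 2 + ε + ε⁻¹ * t ^ 2 + 1 := by field_simp; ring
      rw [h3]
      have h4 : 0 ≤ ε⁻¹ * t ^ 2 := by positivity
      nlinarith [sq_nonneg (|t| - 1), sq_abs t]
    refine (abs_sub _ _).trans (add_le_add ?_ h2)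
    rw [abs_mul, abs_of_nonneg hl]
    exact mul_le_mul_of_nonneg_left (abs_le.2 h1) hl
  · refine (abs_sub _ _).trans (add_le_add ?_ ?_)
    · rw [abs_mul, abs_of_nonneg hl]
      exact mul_le_mul_of_nonneg_left (abs_one_sub_div_le (by positivity)) hl
    · rw [abs_div, abs_of_pos (by positivity : 0 < (t ^ 2 + ε) ^ 2), div_le_iff₀ (by positivity)]
      have h3 : ε⁻¹ * (t ^ 2 + ε) ^ 2 = ε⁻¹ * t ^ 4 + 2 * t ^ 2 + ε := by field_simp; ring
      rw [h3, abs_le]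
      have h4 : 0 ≤ ε⁻¹ * t ^ 4 := by positivity
      constructor <;> nlinarith [sq_nonneg t]

theorem tendsto_div_sq_add {c : ℝ} (hc : 0 < c) :
    Tendsto (fun n : ℕ => (1 / ((n : ℝ) + 1)) / (c + 1 / ((n : ℝ) + 1))) atTop (𝓝 0) := by
  have h := tendsto_one_div_add_atTop_nhds_zero_nat (𝕜 := ℝ)
  have := h.div (h.const_add c) (by simpa using hc.ne')
  simpa [Pi.div_def] using this

/-- As `ε → 0` the term `ε/(t²+ε)²` concentrates at `t = 0` with unbounded mass. Oddness rescues the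
limit: `‖φ‖² ≤ x_j² Ψ` and `εt² ≤ (t²+ε)²` bound its contribution by `Ψ`. -/
theorem integral_truncWeight_nonneg {d : ℕ} {j : Fin d} {φ : 𝓢(Space d, ℂ)}
    (hφ : ∀ x, φ (reflectCoord j x) = -φ x) {l δ : ℝ} (hl : 0 ≤ l) (hδ : 0 < δ) :
    0 ≤ ∫ x, ‖∂_{(EuclideanSpace.single j (1 : ℝ) : Space d)} φ x‖ ^ 2 +
      truncWeight l δ (x j) * ‖φ x‖ ^ 2 := by
  obtain ⟨Ψ, hΨi, hΨ0, hΨ⟩ := exists_integrable_bound_of_odd hφ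
  set ψ := ∂_{(EuclideanSpace.single j (1 : ℝ) : Space d)} φ with hψ
  have hW : ∀ t, |truncWeight l δ t| ≤ l ^ 2 * δ⁻¹ + 3 * l := fun t =>
    (abs_truncWeight_le hl hδ t).trans (by gcongr; exact sq_div_le hδ t)
  have hd1 : ∀ t : ℝ, 1 + δ * t ^ 2 ≠ 0 := fun t => by positivity
  refine ge_of_tendsto' (x := atTop) (f := fun n : ℕ => ∫ x, ‖ψ x‖ ^ 2 +
      (truncWeight l δ (x j) + (1 / ((n : ℝ) + 1)) / (x j ^ 2 + 1 / ((n : ℝ) + 1)) ^ 2 +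
        2 * l / (1 + δ * x j ^ 2) * ((1 / ((n : ℝ) + 1)) / (x j ^ 2 + 1 / ((n : ℝ) + 1)))) *
          ‖φ x‖ ^ 2) ?_
    fun n => integral_truncWeight_add_regularised_nonneg j φ hl hδ (by positivity)
  refine tendsto_integral_of_dominated_convergence
    -- In `5 * l`, three come from the truncated weight and two from the cross term with `ε`.
    (fun x => ‖ψ x‖ ^ 2 + ((l ^ 2 * δ⁻¹ + 5 * l) * ‖φ x‖ ^ 2 + Ψ x)) (fun n => ?_)
    ((integrable_norm_sq_schwartz ψ).add
      (((integrable_norm_sq_schwartz φ).const_mul _).add hΨi)) (fun n => ?_) ?_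
  · have hd2 : ∀ t : ℝ, t ^ 2 + 1 / ((n : ℝ) + 1) ≠ 0 := fun t => by positivity
    have := continuous_truncWeight (l := l) hδ
    have h1 : Continuous φ := φ.continuous
    have h2 : Continuous ψ := ψ.continuous
    refine Continuous.aestronglyMeasurable ?_
    fun_prop (disch := first | exact fun _ => hd1 _ | exact fun _ => hd2 _ |
      exact fun _ => pow_ne_zero _ (hd2 _))
  · refine .of_forall fun x => ?_
    set ε := 1 / ((n : ℝ) + 1) with hεdef
    have hε : 0 < ε := by positivity
    have h1 : ε / (x j ^ 2 + ε) ^ 2 * ‖φ x‖ ^ 2 ≤ Ψ x := by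
      calc ε / (x j ^ 2 + ε) ^ 2 * ‖φ x‖ ^ 2
          ≤ ε / (x j ^ 2 + ε) ^ 2 * (x j ^ 2 * Ψ x) := by gcongr; exact hΨ x
        _ = (ε * x j ^ 2) / (x j ^ 2 + ε) ^ 2 * Ψ x := by ring
        _ ≤ 1 * Ψ x := by
            refine mul_le_mul_of_nonneg_right ?_ (hΨ0 x)
            rw [div_le_one (by positivity)]
            nlinarith [sq_nonneg (x j), sq_nonneg (x j ^ 2)]
        _ = Ψ x := one_mul _
    have h2 : 2 * l / (1 + δ * x j ^ 2) * (ε / (x j ^ 2 + ε)) ≤ 2 * l := by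
      have h3 : 2 * l / (1 + δ * x j ^ 2) ≤ 2 * l := div_le_self (by positivity)
        (by nlinarith [mul_nonneg hδ.le (sq_nonneg (x j))])
      have h4 : ε / (x j ^ 2 + ε) ≤ 1 := by
        rw [div_le_one (by positivity)]; nlinarith [sq_nonneg (x j)]
      calc _ ≤ 2 * l * 1 := by gcongr
        _ = 2 * l := mul_one _
    have h5 : 0 ≤ ε / (x j ^ 2 + ε) ^ 2 := by positivity
    have h6 : 0 ≤ 2 * l / (1 + δ * x j ^ 2) * (ε / (x j ^ 2 + ε)) := by positivity
    have h7 := abs_le.1 (hW (x j))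
    have h8 := sq_nonneg ‖φ x‖
    have h9 := sq_nonneg ‖ψ x‖
    have h10 := hΨ0 x
    have h11 := mul_le_mul_of_nonneg_right h7.1 h8
    have h12 := mul_le_mul_of_nonneg_right h7.2 h8
    have h13 := mul_le_mul_of_nonneg_right h2 h8
    have h14 := mul_nonneg h5 h8
    have h15 := mul_nonneg h6 h8
    have h16 := mul_nonneg hl h8
    rw [Real.norm_eq_abs, abs_le, add_mul, add_mul]
    constructor <;> nlinarith
  · refine .of_forall fun x => ?_
    by_cases hx : x j = 0
    · have h0 : ‖φ x‖ ^ 2 = 0 := by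
        have := hΨ x
        rw [hx] at this
        nlinarith [sq_nonneg ‖φ x‖]
      simp only [h0, mul_zero]
      exact tendsto_const_nhds
    · have hc : 0 < x j ^ 2 := by positivity
      have h1 := tendsto_div_sq_add hc
      have h2 := h1.div ((tendsto_one_div_add_atTop_nhds_zero_nat (𝕜 := ℝ)).const_add (x j ^ 2))
        (by simpa using hx)
      have h3 := (((h2.const_add (truncWeight l δ (x j))).add
        (h1.const_mul (2 * l / (1 + δ * x j ^ 2)))).mul_const (‖φ x‖ ^ 2)).const_add (‖ψ x‖ ^ 2)
      simp only [mul_zero, add_zero, zero_div] at h3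
      refine h3.congr fun n => ?_
      rw [Pi.div_apply, div_div, ← sq]

/-! ### The uncertainty inequality in one coordinate -/

theorem re_inner_eq_integral {d : ℕ} (f g : L2 d) :
    (inner ℂ f g).re = ∫ x, (inner ℂ (f x) (g x)).re := by
  rw [L2.inner_def]
  exact (integral_re (L2.integrable_inner (𝕜 := ℂ) f g)).symm

theorem norm_sq_eq_integral {d : ℕ} (f : L2 d) : ‖f‖ ^ 2 = ∫ x, ‖f x‖ ^ 2 := by
  rw [← inner_self_eq_norm_sq (𝕜 := ℂ) f]
  exact (re_inner_eq_integral f f).trans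
    (integral_congr_ae (.of_forall fun x => inner_self_eq_norm_sq (𝕜 := ℂ) (f x)))

theorem integrable_norm_sq {d : ℕ} (f : L2 d) : Integrable fun x => ‖f x‖ ^ 2 :=
  (memLp_two_iff_integrable_sq_norm (Lp.aestronglyMeasurable f)).1 (Lp.memLp f)

/-- The quadratic form of a bounded continuous weight is continuous on `L_2`. -/
theorem continuous_integral_weight {d : ℕ} {W : Space d → ℝ} (hW : Continuous W) {K : ℝ}
    (hK : ∀ x, |W x| ≤ K) : Continuous fun f : L2 d => ∫ x, W x * ‖f x‖ ^ 2 := by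
  have hmem : MemLp (fun x => (W x : ℂ)) ⊤ (volume : Measure (Space d)) :=
    memLp_top_of_bound (Continuous.aestronglyMeasurable (by fun_prop)) K
      (.of_forall fun x => by simpa using hK x)
  -- Multiplication by `W` is bounded on `L_2` by Hölder, and the integral is its quadratic form.
  let T : L2 d →L[ℂ] L2 d :=
    (ContinuousLinearMap.mul ℂ ℂ).holderL volume ⊤ 2 2 (hmem.toLp _)
  have hT (f : L2 d) : T f =ᵐ[volume] fun x => (W x : ℂ) * f x := by
    filter_upwards [(ContinuousLinearMap.mul ℂ ℂ).coeFn_holder (r := 2) (hmem.toLp _) f,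
      hmem.coeFn_toLp] with x h1 h2
    rw [← h2]
    exact h1
  have hc : Continuous fun f : L2 d => (inner ℂ f (T f)).re :=
    Complex.continuous_re.comp (continuous_id.inner T.continuous)
  refine hc.congr fun f => ?_
  rw [re_inner_eq_integral]
  refine integral_congr_ae ?_
  filter_upwards [hT f] with x hx
  rw [hx, ← smul_eq_mul, inner_smul_right]
  have h : inner ℂ (f x) (f x) = ((‖f x‖ ^ 2 : ℝ) : ℂ) := by
    rw [Complex.ofReal_pow]
    exact inner_self_eq_norm_sq_to_K (𝕜 := ℂ) (f x)
  rw [h, ← Complex.ofReal_mul, Complex.ofReal_re]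

/-- For fixed `δ` the right side is continuous in the graph norm, so the inequality passes from odd
Schwartz functions to their limits. -/
theorem IsWeakPartial.truncWeight_nonneg {d : ℕ} {j : Fin d} {f g : L2 d}
    (h : IsWeakPartial j f g) (hf : reflectOp j f = -f) {l δ : ℝ} (hl : 0 ≤ l) (hδ : 0 < δ) :
    0 ≤ ‖g‖ ^ 2 + ∫ x, truncWeight l δ (x j) * ‖f x‖ ^ 2 := by
  obtain ⟨φ, hodd, h1, h2⟩ := h.exists_seq_odd hf
  have hW : ∀ t, |truncWeight l δ t| ≤ l ^ 2 * δ⁻¹ + 3 * l := fun t =>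
    (abs_truncWeight_le hl hδ t).trans (by gcongr; exact sq_div_le hδ t)
  have hWc : Continuous fun x : Space d => truncWeight l δ (x j) :=
    (continuous_truncWeight hδ).comp (by fun_prop)
  have h3 := ((continuous_integral_weight hWc fun x => hW (x j)).tendsto f).comp h1
  refine ge_of_tendsto' ((h2.norm.pow 2).add h3) fun n => ?_
  refine (integral_truncWeight_nonneg (hodd n) hl hδ).trans_eq ?_
  have i1 := integrable_norm_sq_schwartz (φ n)
  rw [integral_add (integrable_norm_sq_schwartz _)
    (integrable_coord_mul (continuous_truncWeight hδ) hW i1), norm_sq_eq_integral]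
  congr 1
  · refine integral_congr_ae ?_
    filter_upwards [(∂_{(EuclideanSpace.single j (1 : ℝ) : Space d)} (φ n)).coeFn_toLp 2 volume]
      with x hx
    rw [hx]
  · refine integral_congr_ae ?_
    filter_upwards [(φ n).coeFn_toLp 2 volume] with x hx
    simp only
    rw [hx]

theorem tendsto_truncWeight (l t : ℝ) :
    Tendsto (fun n : ℕ => truncWeight l (1 / ((n : ℝ) + 1)) t) atTop
      (𝓝 (l ^ 2 * t ^ 2 - 3 * l)) := by
  have hc : ContinuousAt (fun δ : ℝ => truncWeight l δ t) 0 := by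
    unfold truncWeight
    fun_prop (disch := simp)
  have h := hc.tendsto.comp (tendsto_one_div_add_atTop_nhds_zero_nat (𝕜 := ℝ))
  -- The constant 3 appears here: `l` from the derivative of `lt` and `2l` from the cross term of
  -- `lt` with `1/t`.
  have h0 : truncWeight l 0 t = l ^ 2 * t ^ 2 - 3 * l := by
    simp [truncWeight]; ring
  rw [h0] at h
  exact h

/-- A weighted sum form of the uncertainty inequality for functions odd in `x_j`. -/
theorem IsWeakPartial.three_mul_norm_sq_le {d : ℕ} {j : Fin d} {f g : L2 d}
    (h : IsWeakPartial j f g) (hf : reflectOp j f = -f)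
    (hx : Integrable fun x : Space d => x j ^ 2 * ‖f x‖ ^ 2) {l : ℝ} (hl : 0 ≤ l) :
    3 * l * ‖f‖ ^ 2 ≤ ‖g‖ ^ 2 + l ^ 2 * ∫ x, x j ^ 2 * ‖f x‖ ^ 2 := by
  have hi := integrable_norm_sq f
  have h1 : Tendsto (fun n : ℕ => ∫ x, truncWeight l (1 / ((n : ℝ) + 1)) (x j) * ‖f x‖ ^ 2) atTop
      (𝓝 (∫ x, (l ^ 2 * x j ^ 2 - 3 * l) * ‖f x‖ ^ 2)) := by
    refine tendsto_integral_of_dominated_convergence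
      (fun x => l ^ 2 * (x j ^ 2 * ‖f x‖ ^ 2) + 3 * l * ‖f x‖ ^ 2) (fun n => ?_)
      ((hx.const_mul _).add (hi.const_mul _)) (fun n => .of_forall fun x => ?_)
      (.of_forall fun x => (tendsto_truncWeight l (x j)).mul_const _)
    · refine AEStronglyMeasurable.mul (Continuous.aestronglyMeasurable ?_) hi.1
      exact (continuous_truncWeight (by positivity)).comp (by fun_prop)
    · have hδ : 0 < 1 / ((n : ℝ) + 1) := by positivity
      rw [norm_mul, Real.norm_eq_abs, norm_pow, norm_norm, ← mul_assoc, ← add_mul]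
      refine mul_le_mul_of_nonneg_right ((abs_truncWeight_le hl hδ _).trans ?_) (by positivity)
      refine add_le_add (mul_le_mul_of_nonneg_left ?_ (sq_nonneg l)) le_rfl
      rw [div_pow]
      refine div_le_self (sq_nonneg _) (one_le_pow₀ ?_)
      have : 0 ≤ 1 / ((n : ℝ) + 1) * x j ^ 2 := by positivity
      linarith
  have h2 := ge_of_tendsto' (h1.const_add (‖g‖ ^ 2))
    fun n => h.truncWeight_nonneg hf hl (by positivity)
  have h3 : ∫ x, (l ^ 2 * x j ^ 2 - 3 * l) * ‖f x‖ ^ 2 =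
      l ^ 2 * (∫ x, x j ^ 2 * ‖f x‖ ^ 2) - 3 * l * ‖f‖ ^ 2 := by
    rw [norm_sq_eq_integral f, ← integral_const_mul, ← integral_const_mul,
      ← integral_sub (hx.const_mul _) (hi.const_mul _)]
    exact integral_congr_ae (.of_forall fun x => by simp only; ring)
  rw [h3] at h2
  linarith

/-! ### Directional operators on odd functions -/

theorem inner_eq_zero_of_map_eq_neg {H : Type*} [NormedAddCommGroup H] [InnerProductSpace ℂ H]
    (R : H →ₗᵢ[ℂ] H) {u v : H} (hu : R u = u) (hv : R v = -v) : inner ℂ u v = 0 := by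
  have h := R.inner_map_map u v
  rw [hu, hv, inner_neg_right] at h
  exact self_eq_neg.1 h.symm

theorem norm_sq_sum_smul_of_orthogonal {ι H : Type*} [Fintype ι] [NormedAddCommGroup H]
    [InnerProductSpace ℂ H] {v : ι → H} (hv : ∀ i k, i ≠ k → inner ℂ (v i) (v k) = 0)
    (c : ι → ℝ) : ‖∑ i, (c i : ℂ) • v i‖ ^ 2 = ∑ i, c i ^ 2 * ‖v i‖ ^ 2 := by
  have h : ((‖∑ i, (c i : ℂ) • v i‖ ^ 2 : ℝ) : ℂ) = ((∑ i, c i ^ 2 * ‖v i‖ ^ 2 : ℝ) : ℂ) := by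
    push_cast
    have h0 := inner_self_eq_norm_sq_to_K (𝕜 := ℂ) (∑ i, (c i : ℂ) • v i)
    refine h0.symm.trans ?_
    rw [sum_inner]
    refine Finset.sum_congr rfl fun i _ => ?_
    rw [inner_sum, Finset.sum_eq_single i]
    · have h1 := inner_self_eq_norm_sq_to_K (𝕜 := ℂ) (v i)
      rw [inner_smul_left, inner_smul_right, h1, Complex.conj_ofReal]
      simp only [Complex.coe_algebraMap]
      ring
    · intro k _ hk
      rw [inner_smul_left, inner_smul_right, hv i k hk.symm, mul_zero, mul_zero]
    · simp
  exact_mod_cast h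

/-- A directional combination of the components `v k` of a vector operator applied to an odd
function has zero mean and its squared norm splits. -/
theorem norm_sq_sum_of_reflect {d : ℕ} {v : Fin d → L2 d}
    (h1 : ∀ k, reflectOp k (v k) = v k) (h2 : ∀ k j, j ≠ k → reflectOp k (v j) = -v j)
    (c : Fin d → ℝ) : ‖∑ k, (c k : ℂ) • v k‖ ^ 2 = ∑ k, c k ^ 2 * ‖v k‖ ^ 2 :=
  norm_sq_sum_smul_of_orthogonal
    (fun i k hik => inner_eq_zero_of_map_eq_neg (reflectOp i) (h1 i) (h2 i k hik.symm)) c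

theorem inner_sum_of_reflect {d : ℕ} {v : Fin d → L2 d} {f : L2 d}
    (h1 : ∀ k, reflectOp k (v k) = v k) (hf : ∀ k, reflectOp k f = -f)
    (c : Fin d → ℝ) : inner ℂ (∑ k, (c k : ℂ) • v k) f = 0 := by
  rw [sum_inner]
  refine Finset.sum_eq_zero fun k _ => ?_
  rw [inner_smul_left, inner_eq_zero_of_map_eq_neg (reflectOp k) (h1 k) (hf k), mul_zero]

theorem coeFn_sum_smul {d : ℕ} {ι : Type*} (s : Finset ι) (c : ι → ℂ) (v : ι → L2 d) :
    (∑ k ∈ s, c k • v k : L2 d) =ᵐ[volume] fun x => ∑ k ∈ s, c k * v k x := by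
  classical
  induction s using Finset.induction_on with
  | empty =>
    simp only [Finset.sum_empty]
    exact Lp.coeFn_zero ℂ 2 _
  | insert a s ha ih =>
    rw [Finset.sum_insert ha]
    filter_upwards [Lp.coeFn_add (c a • v a) (∑ k ∈ s, c k • v k), Lp.coeFn_smul (c a) (v a), ih]
      with x h1 h2 h3
    rw [h1, Pi.add_apply, h2, h3, Finset.sum_insert ha, Pi.smul_apply, smul_eq_mul]

/-! ### Coordinate components of the two operators -/

theorem coeFn_opA {d : ℕ} (L : Space d) (f : (opA L).domain) :
    opA L f =ᵐ[volume] fun x => ((2 * Real.pi * inner ℝ L x : ℝ) : ℂ) * (f : L2 d) x :=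
  (memLp_position L f.2).coeFn_toLp

/-- The operator of multiplication by `2π x_k`. -/
def coordMul {d : ℕ} (k : Fin d) (f : positionDomain d) : L2 d :=
  opA (EuclideanSpace.single k (1 : ℝ)) f

theorem coeFn_coordMul {d : ℕ} (k : Fin d) (f : positionDomain d) :
    coordMul k f =ᵐ[volume] fun x => ((2 * Real.pi * x k : ℝ) : ℂ) * (f : L2 d) x := by
  filter_upwards [coeFn_opA (EuclideanSpace.single k (1 : ℝ)) f] with x hx
  rw [coordMul, hx]
  simp [EuclideanSpace.inner_single_left]

theorem opA_eq_sum {d : ℕ} (L : Space d) (f : (opA L).domain) :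
    opA L f = ∑ k, (L k : ℂ) • coordMul k f := by
  refine Lp.ext ?_
  filter_upwards [coeFn_opA L f, coeFn_sum_smul Finset.univ (fun k => (L k : ℂ))
    (fun k => coordMul k f), ae_all_iff.2 fun k => coeFn_coordMul k f] with x h1 h2 h3
  rw [h1, h2]
  simp only [h3]
  simp only [PiLp.inner_apply, RCLike.inner_apply, conj_trivial]
  push_cast
  rw [Finset.mul_sum, Finset.sum_mul]
  exact Finset.sum_congr rfl fun k _ => by ring

theorem reflectOp_coordMul_same {d : ℕ} {k : Fin d} {f : positionDomain d}
    (hf : reflectOp k (f : L2 d) = -(f : L2 d)) :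
    reflectOp k (coordMul k f) = coordMul k f := by
  have hf' := coeFn_reflectOp k (f : L2 d)
  rw [hf] at hf'
  refine Lp.ext ?_
  filter_upwards [coeFn_reflectOp k (coordMul k f), coeFn_coordMul k f, hf',
    Lp.coeFn_neg (f : L2 d), (measurePreserving_reflectCoord k).quasiMeasurePreserving.ae_eq_comp
      (coeFn_coordMul k f)] with x h1 h2 h3 h4 h5
  rw [Function.comp_apply, Function.comp_apply] at h5
  rw [h1, h2, h5, ← h3, h4, Pi.neg_apply, reflectCoord_apply_same]
  push_cast
  ring

theorem reflectOp_coordMul_of_ne {d : ℕ} {j k : Fin d} (hjk : j ≠ k) {f : positionDomain d}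
    (hf : reflectOp k (f : L2 d) = -(f : L2 d)) :
    reflectOp k (coordMul j f) = -coordMul j f := by
  have hf' := coeFn_reflectOp k (f : L2 d)
  rw [hf] at hf'
  refine Lp.ext ?_
  filter_upwards [coeFn_reflectOp k (coordMul j f), coeFn_coordMul j f, hf',
    Lp.coeFn_neg (f : L2 d), Lp.coeFn_neg (coordMul j f),
    (measurePreserving_reflectCoord k).quasiMeasurePreserving.ae_eq_comp
      (coeFn_coordMul j f)] with x h1 h2 h3 h4 h5 h6
  rw [Function.comp_apply, Function.comp_apply] at h6
  rw [h1, h5, Pi.neg_apply, h2, h6, ← h3, h4, Pi.neg_apply, reflectCoord_apply_of_ne hjk, mul_neg]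

theorem integrable_coord_sq {d : ℕ} (k : Fin d) (f : positionDomain d) :
    Integrable fun x : Space d => x k ^ 2 * ‖(f : L2 d) x‖ ^ 2 := by
  have hi := integrable_norm_sq (f : L2 d)
  have h : Integrable (fun x : Space d => ‖x‖ ^ 2 * ‖(f : L2 d) x‖ ^ 2) := f.2
  refine h.mono' (AEStronglyMeasurable.mul (Continuous.aestronglyMeasurable (by fun_prop)) hi.1)
    (.of_forall fun x => ?_)
  rw [Real.norm_eq_abs, abs_of_nonneg (by positivity)]
  refine mul_le_mul_of_nonneg_right ?_ (by positivity)
  rw [← sq_abs (x k)]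
  exact pow_le_pow_left₀ (abs_nonneg _) (PiLp.norm_apply_le x k) 2

theorem norm_sq_coordMul {d : ℕ} (k : Fin d) (f : positionDomain d) :
    ‖coordMul k f‖ ^ 2 = (2 * Real.pi) ^ 2 * ∫ x, x k ^ 2 * ‖(f : L2 d) x‖ ^ 2 := by
  rw [norm_sq_eq_integral, ← integral_const_mul]
  refine integral_congr_ae ?_
  filter_upwards [coeFn_coordMul k f] with x hx
  rw [hx, norm_mul, Complex.norm_real, Real.norm_eq_abs, mul_pow, sq_abs, mul_pow, mul_assoc]

theorem opB_eq_sum {d : ℕ} (L : Space d) (f : (opB L).domain) :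
    opB L f = (Complex.I / (2 * Real.pi)) • ∑ k, (L k : ℂ) • weakPartial k f := by
  have h (g : sobolevH1 d) :
      ((Complex.I / (2 * Real.pi)) • ∑ k : Fin d, (L k : ℂ) • weakPartial k) g =
        (Complex.I / (2 * Real.pi)) • ∑ k, (L k : ℂ) • weakPartial k g := by
    simp only [LinearMap.smul_apply, LinearMap.sum_apply]
  exact h f

/-! ### Variances of odd functions and the discriminant argument -/

theorem variance_eq_norm_sq {H : Type*} [NormedAddCommGroup H] [InnerProductSpace ℂ H]
    {T : H →ₗ.[ℂ] H} {f : T.domain} (h : inner ℂ (T f) (f : H) = 0) :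
    variance T f = ‖T f‖ ^ 2 := by
  rw [variance, h, norm_zero, zero_pow two_ne_zero, zero_div, sub_zero]

theorem variance_opA_of_odd {d : ℕ} (L : Space d) (f : (opA L).domain)
    (hf : ∀ k, reflectOp k (f : L2 d) = -(f : L2 d)) :
    variance (opA L) f = (2 * Real.pi) ^ 2 *
      ∑ k, L k ^ 2 * ∫ x, x k ^ 2 * ‖(f : L2 d) x‖ ^ 2 := by
  have h1 := fun k => reflectOp_coordMul_same (f := f) (hf k)
  rw [variance_eq_norm_sq (by rw [opA_eq_sum]; exact inner_sum_of_reflect h1 hf _), opA_eq_sum,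
    norm_sq_sum_of_reflect h1 fun k j hjk => reflectOp_coordMul_of_ne hjk (hf k), Finset.mul_sum]
  exact Finset.sum_congr rfl fun k _ =>
    (congrArg (L k ^ 2 * ·) (norm_sq_coordMul k f)).trans (mul_left_comm _ _ _)

theorem variance_opB_of_odd {d : ℕ} (L : Space d) (f : (opB L).domain)
    (hf : ∀ k, reflectOp k (f : L2 d) = -(f : L2 d)) :
    variance (opB L) f = ((2 * Real.pi) ^ 2)⁻¹ * ∑ k, L k ^ 2 * ‖weakPartial k f‖ ^ 2 := by
  have h1 := fun k => (weakPartial_spec k f).reflectOp_eq_of_odd (hf k)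
  have h2 := fun k j (hjk : j ≠ k) => (weakPartial_spec j f).reflectOp_eq_neg_of_odd hjk (hf k)
  have hc : ‖Complex.I / (2 * Real.pi)‖ = (2 * Real.pi)⁻¹ := by
    simp [abs_of_pos Real.pi_pos]
  have h0 : inner ℂ (opB L f) (f : L2 d) = 0 := by
    rw [opB_eq_sum, inner_smul_left, inner_sum_of_reflect h1 hf, mul_zero]
  rw [variance_eq_norm_sq h0, opB_eq_sum, norm_smul, mul_pow, norm_sq_sum_of_reflect h1 h2, hc,
    inv_pow]

theorem nine_mul_sq_le_of_odd {d : ℕ} (L : Space d) (f : L2 d) (hx : f ∈ positionDomain d)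
    (hd : f ∈ sobolevH1 d) (hf : ∀ k, reflectOp k f = -f) :
    9 * (‖L‖ ^ 2 * ‖f‖ ^ 2) ^ 2 ≤ 4 * ((∑ k, L k ^ 2 * ∫ x, x k ^ 2 * ‖f x‖ ^ 2) *
      ∑ k, L k ^ 2 * ‖weakPartial k ⟨f, hd⟩‖ ^ 2) := by
  set P := ∑ k, L k ^ 2 * ∫ x, x k ^ 2 * ‖f x‖ ^ 2 with hP
  set Q := ∑ k, L k ^ 2 * ‖weakPartial k ⟨f, hd⟩‖ ^ 2 with hQ
  have hP0 : 0 ≤ P := Finset.sum_nonneg fun k _ =>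
    mul_nonneg (sq_nonneg _) (integral_nonneg fun x => by positivity)
  have hQ0 : 0 ≤ Q := Finset.sum_nonneg fun k _ => by positivity
  have hN0 : 0 ≤ ‖L‖ ^ 2 * ‖f‖ ^ 2 := by positivity
  have key : ∀ l : ℝ, 0 ≤ P * (l * l) + -(3 * (‖L‖ ^ 2 * ‖f‖ ^ 2)) * l + Q := by
    intro l
    rcases le_total 0 l with hl | hl
    · have h : ∑ k, L k ^ 2 * (3 * l * ‖f‖ ^ 2) ≤ ∑ k, L k ^ 2 *
          (‖weakPartial k ⟨f, hd⟩‖ ^ 2 + l ^ 2 * ∫ x, x k ^ 2 * ‖f x‖ ^ 2) := by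
        refine Finset.sum_le_sum fun k _ => mul_le_mul_of_nonneg_left ?_ (sq_nonneg _)
        exact (weakPartial_spec k ⟨f, hd⟩).three_mul_norm_sq_le (hf k)
          (integrable_coord_sq k ⟨f, hx⟩) hl
      rw [← Finset.sum_mul, ← EuclideanSpace.real_norm_sq_eq] at h
      simp only [mul_add, Finset.sum_add_distrib] at h
      have h3 : ∑ k, L k ^ 2 * (l ^ 2 * ∫ x, x k ^ 2 * ‖f x‖ ^ 2) = l ^ 2 * P := by
        rw [hP, Finset.mul_sum]
        exact Finset.sum_congr rfl fun k _ => by ring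
      rw [h3, ← hQ] at h
      linarith
    -- For `l ≤ 0` all three terms are nonnegative; the analytic inequality is needed only for `l ≥
    -- 0`.
    · nlinarith [mul_nonneg hP0 (mul_self_nonneg l), mul_nonneg hN0 (neg_nonneg.2 hl)]
  have h := discrim_le_zero key
  rw [discrim] at h
  linarith

end DirectionalUncertainty

end

theorem lemma3p6 (d : ℕ) (L : EuclideanSpace ℝ (Fin d)) (hL : L ≠ 0)
    (f : ↥((DirectionalUncertainty.opA L).domain ⊓ (DirectionalUncertainty.opB L).domain))
    (hf : f ≠ 0)
    (hodd : ∀ k : Fin d, ∀ᵐ x : EuclideanSpace ℝ (Fin d),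
      (f : DirectionalUncertainty.L2 d) x =
        -(f : DirectionalUncertainty.L2 d) (DirectionalUncertainty.reflectCoord k x)) :
    9 / 4 ≤ DirectionalUncertainty.UP L f := by
  have hrefl := fun k => DirectionalUncertainty.reflectOp_eq_neg (hodd k)
  have h := DirectionalUncertainty.nine_mul_sq_le_of_odd L f f.2.1 f.2.2 hrefl
  have hf0 : 0 < ‖(f : DirectionalUncertainty.L2 d)‖ :=
    norm_pos_iff.2 fun h0 => hf (Subtype.ext h0)
  have hL0 : 0 < ‖L‖ := norm_pos_iff.2 hL
  -- The factors `(2π)²` and `((2π)²)⁻¹` of the two variances cancel.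
  rw [DirectionalUncertainty.UP,
    DirectionalUncertainty.variance_opA_of_odd L ⟨f, f.2.1⟩ hrefl,
    DirectionalUncertainty.variance_opB_of_odd L ⟨f, f.2.2⟩ hrefl,
    mul_mul_mul_comm, mul_inv_cancel₀ (by positivity), one_mul, le_div_iff₀ (by positivity)]
  have h' : 9 / 4 * (‖L‖ ^ 4 * ‖(f : DirectionalUncertainty.L2 d)‖ ^ 4) ≤
      (∑ k, L k ^ 2 * ∫ x : DirectionalUncertainty.Space d,
        x k ^ 2 * ‖(f : DirectionalUncertainty.L2 d) x‖ ^ 2) *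
      ∑ k, L k ^ 2 * ‖DirectionalUncertainty.weakPartial k ⟨f, f.2.2⟩‖ ^ 2 := by
    linarith
  exact h'
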